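/- Let $S$ be a finite state set, let $A(s)$ be the finite set of actions available in $s\in S$, with transition probabilities $p(s'\mid s,a)$, and let $\Omega_p$ be a finite set of transmission power levels. Let $\theta(s,p)\in[0,1)$ be the packet dropout probabilities, $c_M(s,a)$ and $c_p(s,p)$ real costs (the case $c_p(s,p)=c_p(p)$ is included), and $\lambda>0$. A stationary joint policy is a pair $\mu=(\mu^m,\mu^p)$, where for every $s$, $\mu^m_s$ is a probability distribution on $A(s)$ and $\mu^p_s$ one on $\Omega_p$. At time $k$ the action $a_k$ and the power $p_k$ are drawn independently from $\mu^m_{s_k}$ and $\mu^p_{s_k}$, and then $s_{k+1}$ from $p(\cdot\mid s_k,a_k)$. The average cost from $s_0$ is $$J(s_0,\mu)=\lim_{T\to\infty}\frac1T\,\mathbb E^{\mu}_{s_0}\sum_{k=0}^{T}\bigl(c_M(s_k,a_k)+\lambda c_p(s_k,p_k)\bigr).$$ Assume that the process is unichain: for every stationary $\mu^m$ the Markov chain with transition matrix $\sum_a p(s'\mid s,a)\mu^m_s(a)$ has a single ergodic class (transient states are allowed). Let $\varrho>0$, $\lambda_1<\lambda_0$ and $\eta<1$ be real, put $\tau(\eta)=\frac{\eta-\lambda_1\varrho}{\varrho(\lambda_0-\lambda_1)}$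 and $\overline\eta=\tau(\eta)$, and let $$L_s(\mu)=\sum_{s'\in S,\,p'\in\Omega_p}\theta(s',p')\mu^p_s(p')\sum_{a\in A(s)}p(s'\mid s,a)\mu^m_s(a).$$ The ASAS (almost sure asymptotic safety) constraint is $L_s(\mu)<\tau(1)$ for all $s$; the safety constraint with rate $\eta$ is $L_s(\mu)\le\overline\eta$ for all $s$. The co-design problem is to minimize $J(s_0,\mu)$ over the stationary joint policies that satisfy the safety constraint. For $X=(X(s,a,p))_{s\in S,\,a\in A(s),\,p\in\Omega_p}$ write $X(s,a)$, $X(s,p)$, $X(s)$ for the sums over the missing indices. Consider the program $$\min_X\ \sum_{s,a,p}X(s,a,p)\,[c_M(s,a)+\lambda c_p(s,p)]$$ subject to $X\ge0$, $\sum_{s,a,p}X(s,a,p)=1$, and, for all $s,s'\in S$, $X(s)\neq0$, $$\sum_{a\in A(s')}X(s',a)-\sum_{r\in S,\,a\in A(r)}p(s'\mid r,a)X(r,a)=0,$$ $$\sum_{s'\in S}\Bigl(\sum_{p'\in\Omega_p}\frac{\theta(s',p')X(s,p')}{X(s)}\Bigr)\Bigl(\sum_{a\in A(s)}\frac{p(s'\mid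 s,a)X(s,a)}{X(s)}\Bigr)\le\overline\eta .$$ Where $X(s)\ne0$, the last constraint is the quadratic constraint $X^{T}Q_sX\ge0$, where $Q_s=Q_s(\overline\eta,\theta,p)$ is the symmetric matrix of the quadratic form $$\overline\eta X(s)^2-\sum_{s'\in S}\Bigl(\sum_{p'\in\Omega_p}\theta(s',p')X(s,p')\Bigr)\Bigl(\sum_{a\in A(s)}p(s'\mid s,a)X(s,a)\Bigr).$$ For a feasible $X$ define the policies $$\mu^{m}_{s}(a)=\frac{\sum_{p}X(s,a,p)}{\sum_{b,p}X(s,b,p)},\qquad \mu^{p}_{s}(p)=\frac{\sum_{a}X(s,a,p)}{\sum_{a,q}X(s,a,q)}.$$ 1. Suppose that $Q_s$ is negative semidefinite for every $s\in S$. Then the program is convex (its feasible set is convex and its objective is linear). If $X^*$ is an optimal solution of it, the policies $\mu$ defined by $X^*$ are, for every initial state $s_0$, optimal stationary policies of the co-design problem under the ASAS constraint, and also under the safety constraint with rate $\eta$; and $J(s_0,\mu)$ is the optimal value of the program. The average costs of all competing policies exist as limits. 2. Without any assumption on the $Q_s$: if $X^*$ is an optimal solution of the program, the policies $\mu$ defined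 by $X^*$ satisfy the safety constraint with rate $\eta$, make every state recurrent, and for every $s_0$ minimize $J(s_0,\cdot)$ among all stationary policies with these two properties, and $J(s_0,\mu)$ is the optimal value of the program. Conversely, every stationary joint policy that is optimal in this sense for some $s_0$ is defined by some optimal solution $X^*$ of the program. -/

import Mathlib

open Filter Topology

/-- A finite Markov decision process with state set `S`, action sets `A s` (the actions available
in state `s`) together with a finite set `Ω` of transmission power levels and a state-dependent
dropout channel. -/
structure CoDesignModel (S : Type*) [Fintype S] (A : S → Type*) [∀ s, Fintype (A s)]
    (Ω : Type*) [Fintype Ω] where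
  /-- `trans s a s'` is the transition probability `p(s' | s, a)`. -/
  trans : (s : S) → A s → S → ℝ
  trans_nonneg : ∀ s a s', 0 ≤ trans s a s'
  trans_sum : ∀ s a, ∑ s', trans s a s' = 1
  /-- `theta s p` is the dropout probability in state `s` at power level `p`. -/
  theta : S → Ω → ℝ
  theta_nonneg : ∀ s p, 0 ≤ theta s p
  theta_lt_one : ∀ s p, theta s p < 1
  /-- the cost of an action in a state -/
  costM : (s : S) → A s → ℝ
  /-- the cost of a power level (allowed to depend on the state) -/
  costP : S → Ω → ℝ
  /-- the weight `λ` of the power cost -/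
  weight : ℝ
  weight_pos : 0 < weight

namespace CoDesignModel

variable {S : Type*} [Fintype S] {A : S → Type*} [∀ s, Fintype (A s)] {Ω : Type*} [Fintype Ω]

/-- The state-action-power triples; `⟨s, a, p⟩` has `a` available in `s`. -/
abbrev Triple (S : Type*) (A : S → Type*) (Ω : Type*) : Type _ := Σ s : S, A s × Ω

/-! ### Stationary policies and the average cost -/

/-- `(muM, muP)` is a pair of stationary randomized policies: `muM s` is a probability
distribution over the actions in `s`, `muP s` one over the power levels. -/
def IsPolicy (muM : (s : S) → A s → ℝ) (muP : S → Ω → ℝ) : Prop :=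
  (∀ s, muM s ∈ stdSimplex ℝ (A s)) ∧ (∀ s, muP s ∈ stdSimplex ℝ Ω)

/-- One-stage cost `c_M(s, a) + λ c_p(s, p)`. -/
def stageCost (M : CoDesignModel S A Ω) (z : Triple S A Ω) : ℝ :=
  M.costM z.1 z.2.1 + M.weight * M.costP z.1 z.2.2

open Classical in
/-- Probability, under stationary policies and the initial state `s0`, that the process
`(s_k, a_k, p_k)`, `0 ≤ k ≤ T`, follows the path `z`: given the past and `s_k`, the action and the
power level are drawn from `muM s_k` and `muP s_k`, and then `s_{k+1}` from `p(· | s_k, a_k)`. -/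
noncomputable def pathProb (M : CoDesignModel S A Ω) (muM : (s : S) → A s → ℝ) (muP : S → Ω → ℝ)
    (s0 : S) (T : ℕ) (z : Fin (T + 1) → Triple S A Ω) : ℝ :=
  (if (z 0).1 = s0 then 1 else 0) *
    (∏ k : Fin (T + 1), muM (z k).1 (z k).2.1 * muP (z k).1 (z k).2.2) *
    ∏ k : Fin T, M.trans (z k.castSucc).1 (z k.castSucc).2.1 (z k.succ).1

/-- The expectation of the total cost `∑_{k=0}^{T} (c_M(s_k, a_k) + λ c_p(s_k, p_k))`. -/
noncomputable def expectedTotalCost (M : CoDesignModel S A Ω) (muM : (s : S) → A s → ℝ)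
    (muP : S → Ω → ℝ) (s0 : S) (T : ℕ) : ℝ :=
  ∑ z : Fin (T + 1) → Triple S A Ω, M.pathProb muM muP s0 T z * ∑ k, M.stageCost (z k)

/-- The infinite-horizon average cost `J(s0, muM, muP)` exists and equals `J`. -/
def HasAverageCost (M : CoDesignModel S A Ω) (muM : (s : S) → A s → ℝ) (muP : S → Ω → ℝ)
    (s0 : S) (J : ℝ) : Prop :=
  Tendsto (fun T : ℕ => 1 / (T : ℝ) * M.expectedTotalCost muM muP s0 T) atTop (𝓝 J)

/-! ### The unichain condition -/

/-- Transition matrix of the states under a stationary control policy. -/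
def transMatrix (M : CoDesignModel S A Ω) (muM : (s : S) → A s → ℝ) : Matrix S S ℝ :=
  fun s s' => ∑ a, M.trans s a s' * muM s a

/-- `j` is accessible from `i` (in finitely many, possibly zero, steps). -/
def Accessible (P : Matrix S S ℝ) (i j : S) : Prop :=
  Relation.ReflTransGen (fun s s' => 0 < P s s') i j

/-- Recurrence of a state of a finite Markov chain: `i` can be reached back from every state that
is accessible from `i`. -/
def IsRecurrent (P : Matrix S S ℝ) (i : S) : Prop :=
  ∀ j, Accessible P i j → Accessible P j i

/-- Every stationary control policy induces a Markov chain with a single ergodic class (transient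
states are allowed; aperiodicity is not required). -/
def IsUnichain (M : CoDesignModel S A Ω) : Prop :=
  ∀ muM : (s : S) → A s → ℝ, (∀ s, muM s ∈ stdSimplex ℝ (A s)) →
    ∀ i j, IsRecurrent (M.transMatrix muM) i → IsRecurrent (M.transMatrix muM) j →
      Accessible (M.transMatrix muM) i j

/-! ### The co-design problem -/

/-- Left-hand side of the almost sure safety condition in state `s`:
`∑_{s', p'} θ(s', p') μ^p(p' | s) ∑_a p(s' | s, a) μ^m(a | s)`. -/
def safetyLoad (M : CoDesignModel S A Ω) (muM : (s : S) → A s → ℝ) (muP : S → Ω → ℝ) (s : S) : ℝ :=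
  ∑ s', ∑ p', M.theta s' p' * muP s p' * ∑ a, M.trans s a s' * muM s a

/-- The threshold `(η - λ₁ϱ) / (ϱ(λ₀ - λ₁))`. -/
noncomputable def threshold (rho lam0 lam1 eta : ℝ) : ℝ :=
  (eta - lam1 * rho) / (rho * (lam0 - lam1))

/-- The sufficient condition for almost sure asymptotic safety, with threshold for `η = 1`. -/
def IsASASSafe (M : CoDesignModel S A Ω) (rho lam0 lam1 : ℝ) (muM : (s : S) → A s → ℝ)
    (muP : S → Ω → ℝ) : Prop :=
  ∀ s, M.safetyLoad muM muP s < threshold rho lam0 lam1 1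

/-- The safety condition with a prescribed rate `η`. -/
def IsRateSafe (M : CoDesignModel S A Ω) (rho lam0 lam1 eta : ℝ) (muM : (s : S) → A s → ℝ)
    (muP : S → Ω → ℝ) : Prop :=
  ∀ s, M.safetyLoad muM muP s ≤ threshold rho lam0 lam1 eta

/-- `(muM, muP)` minimizes the average cost from `s0` among the stationary policies that satisfy
the safety condition `Safe`. -/
def IsOptimalPolicy (M : CoDesignModel S A Ω)
    (Safe : ((s : S) → A s → ℝ) → (S → Ω → ℝ) → Prop) (s0 : S)
    (muM : (s : S) → A s → ℝ) (muP : S → Ω → ℝ) : Prop :=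
  IsPolicy muM muP ∧ Safe muM muP ∧ ∃ J, M.HasAverageCost muM muP s0 J ∧
    ∀ nuM nuP, IsPolicy nuM nuP → Safe nuM nuP →
      ∃ J', M.HasAverageCost nuM nuP s0 J' ∧ J ≤ J'

/-! ### The quadratic program -/

/-- `X(s, a) = ∑_p X(s, a, p)` -/
def margA (X : Triple S A Ω → ℝ) (s : S) (a : A s) : ℝ := ∑ p, X ⟨s, a, p⟩

/-- `X(s, p) = ∑_a X(s, a, p)` -/
def margP (X : Triple S A Ω → ℝ) (s : S) (p : Ω) : ℝ := ∑ a, X ⟨s, a, p⟩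

/-- `X(s) = ∑_{a, p} X(s, a, p)` -/
def margS (X : Triple S A Ω → ℝ) (s : S) : ℝ := ∑ a, ∑ p, X ⟨s, a, p⟩

/-- The objective of the program. -/
def qpCost (M : CoDesignModel S A Ω) (X : Triple S A Ω → ℝ) : ℝ :=
  ∑ z, X z * M.stageCost z

/-- Feasibility for the program with threshold `etaBar`. -/
structure QPFeasible (M : CoDesignModel S A Ω) (etaBar : ℝ) (X : Triple S A Ω → ℝ) : Prop where
  nonneg : ∀ z, 0 ≤ X z
  balance : ∀ s', 0 = ∑ a, margA X s' a - ∑ s, ∑ a, M.trans s a s' * margA X s a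
  total : 1 = ∑ z, X z
  margS_ne_zero : ∀ s, margS X s ≠ 0
  safety : ∀ s, ∑ s', (∑ p', M.theta s' p' * margP X s p' / margS X s) *
    (∑ a, M.trans s a s' * margA X s a / margS X s) ≤ etaBar

/-- `X` is an optimal solution of the program. -/
def IsQPOptimal (M : CoDesignModel S A Ω) (etaBar : ℝ) (X : Triple S A Ω → ℝ) : Prop :=
  M.QPFeasible etaBar X ∧ ∀ Y, M.QPFeasible etaBar Y → M.qpCost X ≤ M.qpCost Y

/-- The quadratic expression
`η̄ X(s)² - ∑_{s'} (∑_{p'} θ(s', p') X(s, p')) (∑_a p(s' | s, a) X(s, a))`. -/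
def safetyForm (M : CoDesignModel S A Ω) (etaBar : ℝ) (s : S) (X : Triple S A Ω → ℝ) : ℝ :=
  etaBar * margS X s ^ 2 -
    ∑ s', (∑ p', M.theta s' p' * margP X s p') * ∑ a, M.trans s a s' * margA X s a

open Classical in
/-- The symmetric matrix of the quadratic form `safetyForm etaBar s`. -/
noncomputable def safetyQ (M : CoDesignModel S A Ω) (etaBar : ℝ) (s : S) :
    Matrix (Triple S A Ω) (Triple S A Ω) ℝ :=
  fun y z => if y.1 = s ∧ z.1 = s then
    etaBar - (∑ s', (M.theta s' y.2.2 * M.trans z.1 z.2.1 s' +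
      M.theta s' z.2.2 * M.trans y.1 y.2.1 s')) / 2 else 0

theorem safetyQ_isSymm (M : CoDesignModel S A Ω) (etaBar : ℝ) (s : S) :
    (M.safetyQ etaBar s).IsSymm := by
  ext y z
  by_cases hy : y.1 = s <;> by_cases hz : z.1 = s <;>
    simp [Matrix.transpose_apply, safetyQ, hy, hz, add_comm]

theorem dotProduct_safetyQ (M : CoDesignModel S A Ω) (etaBar : ℝ) (s : S)
    (X : Triple S A Ω → ℝ) :
    dotProduct X ((M.safetyQ etaBar s).mulVec X) = M.safetyForm etaBar s X := by
  classical
  have key : ∀ f : Triple S A Ω → ℝ, (∑ z, if z.1 = s then f z else 0) =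
      ∑ u : A s × Ω, f ⟨s, u⟩ := by
    intro f
    rw [Fintype.sum_sigma, Finset.sum_eq_single s]
    · simp
    · intro b _ hb
      simp [hb]
    · simp
  set h : A s × Ω → A s × Ω → ℝ := fun u v => ∑ s', M.theta s' u.2 * M.trans s v.1 s' with hh
  set x : A s × Ω → ℝ := fun u => X ⟨s, u⟩ with hx
  have h1 : dotProduct X ((M.safetyQ etaBar s).mulVec X) =
      ∑ u, ∑ v, x u * x v * (etaBar - (h u v + h v u) / 2) := by
    have h2 : ∀ y, (M.safetyQ etaBar s).mulVec X y = if y.1 = s then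
        ∑ v : A s × Ω, (etaBar - (∑ s', (M.theta s' y.2.2 * M.trans s v.1 s' +
          M.theta s' v.2 * M.trans y.1 y.2.1 s')) / 2) * x v else 0 := by
      intro y
      by_cases hy : y.1 = s
      · rw [if_pos hy, ← key (fun z => (etaBar - (∑ s', (M.theta s' y.2.2 * M.trans z.1 z.2.1 s' +
          M.theta s' z.2.2 * M.trans y.1 y.2.1 s')) / 2) * X z)]
        simp only [Matrix.mulVec, dotProduct, safetyQ, hy, true_and, ite_mul, zero_mul]
      · simp [Matrix.mulVec, dotProduct, safetyQ, hy]
    simp only [dotProduct, h2, mul_ite, mul_zero]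
    rw [key]
    refine Finset.sum_congr rfl fun u _ => ?_
    rw [Finset.mul_sum]
    refine Finset.sum_congr rfl fun v _ => ?_
    simp only [hh, hx, Finset.sum_add_distrib]
    ring
  have h3 : ∑ u, ∑ v, x u * x v * h v u = ∑ u, ∑ v, x u * x v * h u v := by
    rw [Finset.sum_comm]
    exact Finset.sum_congr rfl fun u _ => Finset.sum_congr rfl fun v _ => by ring
  have h4 : ∑ u, ∑ v, x u * x v * (etaBar - (h u v + h v u) / 2) =
      etaBar * (∑ u, x u) ^ 2 - ∑ u, ∑ v, x u * x v * h u v := by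
    have : ∀ u v, x u * x v * (etaBar - (h u v + h v u) / 2) =
        etaBar * (x u * x v) - (x u * x v * h u v) / 2 - (x u * x v * h v u) / 2 := by
      intro u v; ring
    simp only [this, Finset.sum_sub_distrib, ← Finset.sum_div, ← Finset.mul_sum]
    simp only [Finset.mul_sum] at h3 ⊢
    rw [h3, sq, Finset.sum_mul_sum, Finset.mul_sum]
    simp only [Finset.mul_sum]
    ring
  have h5 : ∑ u, ∑ v, x u * x v * h u v =
      ∑ s', (∑ u, M.theta s' u.2 * x u) * ∑ v, M.trans s v.1 s' * x v := by
    simp only [Finset.sum_mul_sum, hh]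
    simp only [Finset.mul_sum]
    rw [Finset.sum_comm (s := (Finset.univ : Finset S))]
    refine Finset.sum_congr rfl fun u _ => ?_
    rw [Finset.sum_comm (s := (Finset.univ : Finset S))]
    exact Finset.sum_congr rfl fun _ _ => Finset.sum_congr rfl fun _ _ => by ring
  rw [h1, h4, h5, safetyForm]
  simp only [margS, margP, margA, hx, Fintype.sum_prod_type, Finset.mul_sum]
  congr 1
  refine Finset.sum_congr rfl fun s' _ => ?_
  rw [Finset.sum_comm (s := (Finset.univ : Finset Ω))]

/-- On the points with `X(s) ≠ 0` the fractional safety constraint is the quadratic one. -/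
theorem safety_iff (M : CoDesignModel S A Ω) (etaBar : ℝ) (s : S) (X : Triple S A Ω → ℝ)
    (h : margS X s ≠ 0) :
    ∑ s', (∑ p', M.theta s' p' * margP X s p' / margS X s) *
      (∑ a, M.trans s a s' * margA X s a / margS X s) ≤ etaBar ↔
    0 ≤ dotProduct X ((M.safetyQ etaBar s).mulVec X) := by
  have hpos : 0 < margS X s ^ 2 := by positivity
  have : ∑ s', (∑ p', M.theta s' p' * margP X s p' / margS X s) *
      (∑ a, M.trans s a s' * margA X s a / margS X s) =
      (∑ s', (∑ p', M.theta s' p' * margP X s p') *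
        ∑ a, M.trans s a s' * margA X s a) / margS X s ^ 2 := by
    rw [Finset.sum_div]
    refine Finset.sum_congr rfl fun s' _ => ?_
    rw [← Finset.sum_div, ← Finset.sum_div, div_mul_div_comm, sq]
  rw [dotProduct_safetyQ, this, div_le_iff₀ hpos, safetyForm, sub_nonneg]

/-- The control policy `X(s, a) / X(s)` read off from `X`. -/
noncomputable def ctrlOf (X : Triple S A Ω → ℝ) (s : S) (a : A s) : ℝ :=
  (∑ p, X ⟨s, a, p⟩) / ∑ b, ∑ p, X ⟨s, b, p⟩

/-- The power policy `X(s, p) / X(s)` read off from `X`. -/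
noncomputable def powOf (X : Triple S A Ω → ℝ) (s : S) (p : Ω) : ℝ :=
  (∑ a, X ⟨s, a, p⟩) / ∑ b, ∑ q, X ⟨s, b, q⟩

end CoDesignModel

/-! Occupation measures translate policies into points of a program with linear objective. A
feasible `X` has all `X(s) > 0`, and the balance equations say that `s ↦ X(s)` is stationary for the
chain of `ctrlOf X`. Hence all states are recurrent, the unichain condition makes the average cost
independent of the initial state, and this cost is `qpCost X`; the fractional constraint is the
safety load of the policies read off from `X`. Here `X` need not have product form: costs and load
only see the marginals in `a` and `p`. Conversely, a safe policy without transient states has a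
positive stationary distribution, and its occupation measure is a feasible point that gives the
policy back. This correspondence (`QPFeasible.hasAverageCost`, `IsPolicy.exists_qpFeasible`) yields
the second assertion.

Under negative semidefiniteness the safety constraint degenerates. A feasible `X` satisfies both
`XᵀQ_sX ≥ 0` and `XᵀQ_sX ≤ 0`, so it lies in the kernel of `Q_s`, which is a linear condition; this
gives convexity. On product measures the form is `η̄` minus the load, so the load is at least `η̄`
even for signed policies. A biaffine function that attains such a lower bound is constant
(`safetyLoad_le_of_posSemidef`); thus one safe policy makes every policy safe. A competitor with
transient states is then handled by averaging its occupation measure with `X`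
(`IsQPOptimal.exists_le`).

Existence of the average costs, periodic chains included, comes from the Poisson equation, which
turns the total cost into a linear term plus a bounded error. -/

namespace CoDesignModel

/-! ### Finite Markov chains -/

section MarkovChain

variable {S : Type*} [Fintype S] {P : Matrix S S ℝ}

/-- The set accessible from any state contains a recurrent state. -/
theorem exists_accessible_isRecurrent (P : Matrix S S ℝ) (i : S) :
    ∃ j, Accessible P i j ∧ IsRecurrent P j := by
  classical
  let R : S → Finset S := fun j => Finset.univ.filter fun k => Accessible P j k
  have hR : ∀ j k, k ∈ R j ↔ Accessible P j k := fun j k => by simp [R]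
  -- Among the states accessible from `i`, take one whose own accessible set is smallest. Moving on
  -- from `j` can only shrink this set, so by minimality it stays the same and still contains `j`.
  obtain ⟨j, hj, hmin⟩ := Finset.exists_min_image (R i) (fun j => (R j).card)
    ⟨i, (hR i i).2 Relation.ReflTransGen.refl⟩
  have hij := (hR i j).1 hj
  refine ⟨j, hij, fun k hjk => ?_⟩
  have hsub : R k ⊆ R j := fun l hl => (hR j l).2 (hjk.trans ((hR k l).1 hl))
  have heq := Finset.eq_of_subset_of_card_le hsub (hmin k ((hR i k).2 (hij.trans hjk)))
  exact (hR k j).1 (heq ▸ (hR j j).2 Relation.ReflTransGen.refl)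

/-- A superharmonic quantity cannot be bounded below by a positive constant. -/
theorem nonpos_of_le_sub_sum [Nonempty S] (hP0 : ∀ i j, 0 ≤ P i j) (hP1 : ∀ i, ∑ j, P i j = 1)
    {g : S → ℝ} {c : ℝ} (h : ∀ i, c ≤ g i - ∑ j, P i j * g j) : c ≤ 0 := by
  obtain ⟨i, -, hi⟩ := Finset.exists_min_image Finset.univ g Finset.univ_nonempty
  have h1 : ∑ j, P i j * g i ≤ ∑ j, P i j * g j :=
    Finset.sum_le_sum fun j _ => mul_le_mul_of_nonneg_left (hi j (Finset.mem_univ j)) (hP0 i j)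
  rw [← Finset.sum_mul, hP1, one_mul] at h1
  linarith [h i]

/-- A harmonic function that attains its maximum at `i` is constant on the states accessible
from `i`. -/
theorem harmonic_eq_of_accessible (hP0 : ∀ i j, 0 ≤ P i j) (hP1 : ∀ i, ∑ j, P i j = 1)
    {h : S → ℝ} (hh : ∀ i, ∑ j, P i j * h j = h i) {i j : S} (hi : ∀ k, h k ≤ h i)
    (hij : Accessible P i j) : h j = h i := by
  induction hij with
  | refl => rfl
  | @tail k l _ hkl ih =>
    -- The maximum is attained at `k`, so the nonnegative gaps have mean zero under `P k` and vanish
    -- at every successor.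
    have hsum : ∑ m, P k m * (h i - h m) = 0 := by
      simp only [mul_sub, Finset.sum_sub_distrib, hh, ← Finset.sum_mul, hP1, ih]
      ring
    have h0 := (Finset.sum_eq_zero_iff_of_nonneg fun m _ =>
      mul_nonneg (hP0 k m) (sub_nonneg.2 (hi m))).1 hsum l (Finset.mem_univ l)
    rcases mul_eq_zero.1 h0 with h1 | h1
    · exact absurd h1 hkl.ne'
    · linarith

/-- If there is only one ergodic class, harmonic functions are constant. -/
theorem harmonic_const (hP0 : ∀ i j, 0 ≤ P i j) (hP1 : ∀ i, ∑ j, P i j = 1)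
    (hU : ∀ i j, IsRecurrent P i → IsRecurrent P j → Accessible P i j)
    {h : S → ℝ} (hh : ∀ i, ∑ j, P i j * h j = h i) (i j : S) : h i = h j := by
  have : Nonempty S := ⟨i⟩
  obtain ⟨a, -, ha⟩ := Finset.exists_max_image Finset.univ h Finset.univ_nonempty
  obtain ⟨b, -, hb⟩ := Finset.exists_min_image Finset.univ h Finset.univ_nonempty
  obtain ⟨a', haa, har⟩ := exists_accessible_isRecurrent P a
  obtain ⟨b', hbb, hbr⟩ := exists_accessible_isRecurrent P b
  have h1 := harmonic_eq_of_accessible hP0 hP1 hh (fun k => ha k (Finset.mem_univ k))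
    (haa.trans (hU a' b' har hbr))
  have h2 := harmonic_eq_of_accessible (h := fun k => -h k) hP0 hP1
    (fun i => by simp [hh]) (fun k => neg_le_neg (hb k (Finset.mem_univ k))) hbb
  have hi1 := ha i (Finset.mem_univ i)
  have hi2 := hb i (Finset.mem_univ i)
  have hj1 := ha j (Finset.mem_univ j)
  have hj2 := hb j (Finset.mem_univ j)
  simp only [neg_inj] at h2
  linarith

/-- Solvability of the Poisson equation of a chain with a single ergodic class. -/
theorem exists_poisson [Nonempty S] (hP0 : ∀ i j, 0 ≤ P i j) (hP1 : ∀ i, ∑ j, P i j = 1)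
    (hU : ∀ i j, IsRecurrent P i → IsRecurrent P j → Accessible P i j) (r : S → ℝ) :
    ∃ (g : S → ℝ) (c : ℝ), ∀ i, r i = g i - ∑ j, P i j * g j + c := by
  obtain ⟨s⟩ := ‹Nonempty S›
  have : Nonempty S := ⟨s⟩
  -- The operator `1 - P` kills constants. Adding the value at a fixed state `s` makes it injective,
  -- hence bijective in finite dimension, and `g s` becomes the constant `c`.
  let Φ : (S → ℝ) →ₗ[ℝ] (S → ℝ) :=
    { toFun := fun g i => g i - ∑ j, P i j * g j + g s
      map_add' := fun g g' => by
        ext i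
        simp only [Pi.add_apply, mul_add, Finset.sum_add_distrib]
        ring
      map_smul' := fun t g => by
        ext i
        simp only [Pi.smul_apply, smul_eq_mul, RingHom.id_apply, mul_left_comm _ t,
          ← Finset.mul_sum]
        ring }
  have hinj : Function.Injective Φ := by
    rw [← LinearMap.ker_eq_bot, LinearMap.ker_eq_bot']
    intro g hg
    have hg' : ∀ i, g i - ∑ j, P i j * g j + g s = 0 := fun i => congrFun hg i
    have h1 : -g s ≤ 0 := nonpos_of_le_sub_sum hP0 hP1 (g := g) fun i => by linarith [hg' i]
    have h2 : g s ≤ 0 := nonpos_of_le_sub_sum hP0 hP1 (g := fun i => -g i) fun i => by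
      simp only [mul_neg, Finset.sum_neg_distrib]
      linarith [hg' i]
    have h3 : g s = 0 := by linarith
    ext i
    rw [harmonic_const hP0 hP1 hU (h := g) (fun i => by linarith [hg' i]) i s, h3]
    rfl
  obtain ⟨g, hg⟩ := (LinearMap.injective_iff_surjective.1 hinj) r
  exact ⟨g, g s, fun i => (congrFun hg i).symm⟩

/-- A finite stochastic matrix has a stationary distribution. -/
theorem exists_stationary [Nonempty S] (hP0 : ∀ i j, 0 ≤ P i j) (hP1 : ∀ i, ∑ j, P i j = 1) :
    ∃ π ∈ stdSimplex ℝ S, ∀ j, ∑ i, π i * P i j = π j := by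
  classical
  -- The constant vector lies in the right kernel, so there is also a left kernel vector `v`, of
  -- unknown signs.
  have hdet : (1 - P).det = 0 := by
    rw [← Matrix.exists_mulVec_eq_zero_iff]
    refine ⟨fun _ => 1, fun h => one_ne_zero (congrFun h (Classical.arbitrary S)), ?_⟩
    rw [Matrix.sub_mulVec, Matrix.one_mulVec]
    ext i
    simp [Matrix.mulVec, dotProduct, hP1]
  obtain ⟨v, hv, hvP⟩ := Matrix.exists_vecMul_eq_zero_iff.2 hdet
  have hv' : ∀ j, ∑ i, v i * P i j = v j := fun j => by
    have := congrFun hvP j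
    rw [Matrix.vecMul_sub, Matrix.vecMul_one] at this
    simp only [Pi.sub_apply, Pi.zero_apply, Matrix.vecMul, dotProduct] at this
    linarith
  -- Taking absolute values costs only an inequality in each coordinate. Both sides have the same
  -- total mass, so equality holds throughout and `|v|` is invariant.
  have hle : ∀ j ∈ Finset.univ, |v j| ≤ ∑ i, |v i| * P i j := fun j _ => by
    rw [← hv' j]
    refine (Finset.abs_sum_le_sum_abs _ _).trans (le_of_eq ?_)
    exact Finset.sum_congr rfl fun i _ => by rw [abs_mul, abs_of_nonneg (hP0 i j)]
  have hsum : ∑ j, |v j| = ∑ j, ∑ i, |v i| * P i j := by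
    rw [Finset.sum_comm]
    simp only [← Finset.mul_sum, hP1, mul_one]
  have heq := (Finset.sum_eq_sum_iff_of_le hle).1 hsum
  have hpos : 0 < ∑ j, |v j| := by
    obtain ⟨k, hk⟩ := Function.ne_iff.1 hv
    exact Finset.sum_pos' (fun j _ => abs_nonneg _) ⟨k, Finset.mem_univ k, abs_pos.2 hk⟩
  refine ⟨fun j => |v j| / ∑ k, |v k|, ⟨fun j => by positivity, ?_⟩, fun j => ?_⟩
  · rw [← Finset.sum_div, div_self hpos.ne']
  · change ∑ i, |v i| / (∑ k, |v k|) * P i j = |v j| / ∑ k, |v k|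
    conv_rhs => rw [heq j (Finset.mem_univ j), Finset.sum_div]
    exact Finset.sum_congr rfl fun i _ => by ring

/-- All states are recurrent if some stationary vector is positive everywhere. -/
theorem isRecurrent_of_stationary_pos (hP0 : ∀ i j, 0 ≤ P i j) (hP1 : ∀ i, ∑ j, P i j = 1)
    {π : S → ℝ} (hpos : ∀ i, 0 < π i) (hπ : ∀ j, ∑ i, π i * P i j = π j) (i : S) :
    IsRecurrent P i := by
  classical
  intro j hij
  set D : Finset S := Finset.univ.filter fun k => Accessible P j k with hD
  have hmem : ∀ k, k ∈ D ↔ Accessible P j k := fun k => by simp [hD]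
  have hin : ∀ k ∈ D, ∑ l ∈ D, P k l = 1 := fun k hk => by
    rw [← hP1 k]
    refine Finset.sum_subset (Finset.subset_univ D) fun l _ hl => ?_
    by_contra hne
    exact hl ((hmem l).2 (((hmem k).1 hk).tail (lt_of_le_of_ne (hP0 k l) (Ne.symm hne))))
  -- No mass leaves the closed set `D`, so stationarity forbids any flow into it. If `i` were
  -- outside `D`, no path from `i` could reach `j ∈ D`.
  have hflow : ∑ k ∈ Dᶜ, π k * ∑ l ∈ D, P k l = 0 := by
    have h1 : ∑ l ∈ D, π l = ∑ k, π k * ∑ l ∈ D, P k l := by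
      simp only [Finset.mul_sum]
      rw [Finset.sum_comm]
      exact Finset.sum_congr rfl fun l _ => (hπ l).symm
    have h2 : ∑ k ∈ D, π k * ∑ l ∈ D, P k l = ∑ k ∈ D, π k :=
      Finset.sum_congr rfl fun k hk => by rw [hin k hk, mul_one]
    rw [← Finset.sum_add_sum_compl D, h2] at h1
    linarith
  have hout : ∀ k, k ∉ D → ∀ l ∈ D, P k l = 0 := fun k hk l hl => by
    have h1 := (Finset.sum_eq_zero_iff_of_nonneg fun k _ =>
      mul_nonneg (hpos k).le (Finset.sum_nonneg fun l _ => hP0 k l)).1 hflow k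
        (Finset.mem_compl.2 hk)
    have h2 := (mul_eq_zero.1 h1).resolve_left (hpos k).ne'
    exact (Finset.sum_eq_zero_iff_of_nonneg fun l _ => hP0 k l).1 h2 l hl
  by_contra hni
  have hstay : ∀ k, Accessible P i k → k ∉ D := fun k hk => by
    induction hk with
    | refl => exact fun h => hni ((hmem i).1 h)
    | @tail k l _ hkl ih => exact fun h => hkl.ne' (hout k ih l h)
  exact hstay j hij ((hmem j).2 Relation.ReflTransGen.refl)

/-- The support of a stationary distribution is closed under accessibility. -/
theorem stationary_pos_of_accessible (hP0 : ∀ i j, 0 ≤ P i j) {π : S → ℝ} (h0 : ∀ i, 0 ≤ π i)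
    (hπ : ∀ j, ∑ i, π i * P i j = π j) {i j : S} (hi : 0 < π i) (hij : Accessible P i j) :
    0 < π j := by
  induction hij with
  | refl => exact hi
  | @tail k l _ hkl ih =>
    rw [← hπ l]
    exact Finset.sum_pos' (fun m _ => mul_nonneg (h0 m) (hP0 m l))
      ⟨k, Finset.mem_univ k, mul_pos ih hkl⟩

/-- The stationary distribution of a recurrent chain with a single class is positive. -/
theorem stationary_pos (hP0 : ∀ i j, 0 ≤ P i j)
    (hU : ∀ i j, IsRecurrent P i → IsRecurrent P j → Accessible P i j)
    (hrec : ∀ i, IsRecurrent P i) {π : S → ℝ} (hmem : π ∈ stdSimplex ℝ S)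
    (hπ : ∀ j, ∑ i, π i * P i j = π j) (j : S) : 0 < π j := by
  obtain ⟨i, -, hi⟩ : ∃ i ∈ Finset.univ, 0 < π i := by
    by_contra! h
    have := Finset.sum_nonpos h
    rw [hmem.2] at this
    linarith
  exact stationary_pos_of_accessible hP0 hmem.1 hπ hi (hU i j (hrec i) (hrec j))

/-- Value iteration `G_{T+1} = r + P G_T`, `G_0 = r`, grows at the rate given by the stationary
mean of `r`. -/
theorem tendsto_valueIteration (hP0 : ∀ i j, 0 ≤ P i j) (hP1 : ∀ i, ∑ j, P i j = 1)
    (hU : ∀ i j, IsRecurrent P i → IsRecurrent P j → Accessible P i j)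
    {π : S → ℝ} (hmem : π ∈ stdSimplex ℝ S) (hπ : ∀ j, ∑ i, π i * P i j = π j)
    {r : S → ℝ} {G : ℕ → S → ℝ} (hG0 : ∀ s, G 0 s = r s)
    (hG : ∀ T s, G (T + 1) s = r s + ∑ s', P s s' * G T s') (s : S) :
    Tendsto (fun T : ℕ => 1 / (T : ℝ) * G T s) atTop (𝓝 (∑ i, π i * r i)) := by
  have : Nonempty S := ⟨s⟩
  obtain ⟨g, c, hgc⟩ := exists_poisson hP0 hP1 hU r
  -- Averaging the Poisson equation against `π` cancels `g`.
  have hc : ∑ i, π i * r i = c := by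
    have h1 : ∑ i, π i * ∑ j, P i j * g j = ∑ j, π j * g j := by
      simp only [Finset.mul_sum, ← mul_assoc]
      rw [Finset.sum_comm]
      simp only [← Finset.sum_mul, hπ]
    simp only [hgc, mul_add, mul_sub, Finset.sum_add_distrib, Finset.sum_sub_distrib, h1,
      ← Finset.sum_mul, hmem.2]
    ring
  rw [hc]
  obtain ⟨b, -, hb⟩ := Finset.exists_max_image Finset.univ (fun i => |g i|) Finset.univ_nonempty
  have hb' : ∀ i, |g i| ≤ |g b| := fun i => hb i (Finset.mem_univ i)
  have hcontr : ∀ e : S → ℝ, (∀ i, |e i| ≤ |g b|) → ∀ i, |∑ j, P i j * e j| ≤ |g b| := by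
    intro e he i
    calc |∑ j, P i j * e j| ≤ ∑ j, |P i j * e j| := Finset.abs_sum_le_sum_abs _ _
      _ ≤ ∑ j, P i j * |g b| := Finset.sum_le_sum fun j _ => by
          rw [abs_mul, abs_of_nonneg (hP0 i j)]
          exact mul_le_mul_of_nonneg_left (he j) (hP0 i j)
      _ = |g b| := by rw [← Finset.sum_mul, hP1, one_mul]
  -- The error equals `-P^(T+1) g`, and `P` contracts the sup norm. The factor is `T + 1` because `G
  -- T` collects the rewards at times `0, …, T`; division by `T` only adds a vanishing term.
  have hbound : ∀ (T : ℕ) i, |G T i - g i - (T + 1) * c| ≤ |g b| := by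
    intro T
    induction T with
    | zero =>
      intro i
      have h1 : G 0 i - g i - ((0 : ℕ) + 1) * c = -∑ j, P i j * g j := by
        rw [hG0, hgc i]
        push_cast
        ring
      rw [h1, abs_neg]
      exact hcontr g hb' i
    | succ T ih =>
      intro i
      have h1 : G (T + 1) i - g i - ((T + 1 : ℕ) + 1) * c =
          ∑ j, P i j * (G T j - g j - (T + 1) * c) := by
        simp only [mul_sub, Finset.sum_sub_distrib, ← Finset.sum_mul, hP1]
        rw [hG, hgc i]
        push_cast
        ring
      rw [h1]
      exact hcontr _ ih i
  have hlim : Tendsto (fun T : ℕ => c + 1 / (T : ℝ) * (G T s - T * c)) atTop (𝓝 (c + 0)) := by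
    refine tendsto_const_nhds.add ?_
    refine tendsto_one_div_atTop_nhds_zero_nat.zero_mul_isBoundedUnder_le ?_
    refine isBoundedUnder_of ⟨|g b| + |g s| + |c|, fun T => ?_⟩
    have h1 : G T s - T * c = (G T s - g s - (T + 1) * c) + g s + c := by ring
    simp only [Function.comp_apply, Real.norm_eq_abs]
    rw [h1]
    exact (abs_add_three _ _ _).trans (by linarith [hbound T s])
  rw [add_zero] at hlim
  refine hlim.congr' ?_
  filter_upwards [eventually_gt_atTop 0] with T hT
  have : (T : ℝ) ≠ 0 := by positivity
  field_simp
  ring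

end MarkovChain

end CoDesignModel
namespace CoDesignModel

set_option linter.unusedSectionVars false

variable {S : Type*} [Fintype S] {A : S → Type*} [∀ s, Fintype (A s)] {Ω : Type*} [Fintype Ω]
  {M : CoDesignModel S A Ω} {muM : (s : S) → A s → ℝ} {muP : S → Ω → ℝ} {X : Triple S A Ω → ℝ}

/-! ### The average cost of a stationary policy -/

theorem transMatrix_nonneg (h : IsPolicy muM muP) (s s' : S) : 0 ≤ M.transMatrix muM s s' :=
  Finset.sum_nonneg fun a _ => mul_nonneg (M.trans_nonneg s a s') ((h.1 s).1 a)

theorem transMatrix_sum (h : IsPolicy muM muP) (s : S) : ∑ s', M.transMatrix muM s s' = 1 := by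
  simp only [transMatrix]
  rw [Finset.sum_comm]
  simp only [← Finset.sum_mul, M.trans_sum, one_mul, (h.1 s).2]

/-- Expected one-stage cost in a state. -/
def stageReward (M : CoDesignModel S A Ω) (muM : (s : S) → A s → ℝ) (muP : S → Ω → ℝ) (s : S) :
    ℝ :=
  ∑ a, ∑ p, muM s a * muP s p * M.stageCost ⟨s, a, p⟩

/-- The indicator of the initial state inside `pathProb` collapses the sum over `s'` to the first
state of `w`. Written this way, the tail is again a path probability, which is what the recursion in
`T` needs. -/
theorem pathProb_cons (s : S) (T : ℕ) (x : Triple S A Ω) (w : Fin (T + 1) → Triple S A Ω) :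
    M.pathProb muM muP s (T + 1) (Fin.cons x w : Fin (T + 1 + 1) → Triple S A Ω) =
      open Classical in (if x.1 = s then 1 else 0) * (muM x.1 x.2.1 * muP x.1 x.2.2) *
        ∑ s', M.trans x.1 x.2.1 s' * M.pathProb muM muP s' T w := by
  classical
  have h1 : ∑ s', M.trans x.1 x.2.1 s' * M.pathProb muM muP s' T w =
      M.trans x.1 x.2.1 (w 0).1 * ((∏ k, muM (w k).1 (w k).2.1 * muP (w k).1 (w k).2.2) *
        ∏ k : Fin T, M.trans (w k.castSucc).1 (w k.castSucc).2.1 (w k.succ).1) := by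
    rw [Finset.sum_eq_single (w 0).1]
    · simp [pathProb]
    · intro b _ hb
      simp [pathProb, hb.symm]
    · simp
  have h2 : ∀ f : Triple S A Ω → ℝ,
      ∏ k, f ((Fin.cons x w : Fin (T + 1 + 1) → Triple S A Ω) k) = f x * ∏ k, f (w k) := fun f => by
    rw [Fin.prod_univ_succ]
    simp only [Fin.cons_zero, Fin.cons_succ]
  have h3 : ∀ f : Triple S A Ω → Triple S A Ω → ℝ,
      ∏ k : Fin (T + 1), f ((Fin.cons x w : Fin (T + 1 + 1) → Triple S A Ω) k.castSucc)
        ((Fin.cons x w : Fin (T + 1 + 1) → Triple S A Ω) k.succ) =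
      f x (w 0) * ∏ k : Fin T, f (w k.castSucc) (w k.succ) := fun f => by
    rw [Fin.prod_univ_succ]
    simp only [Fin.castSucc_zero, Fin.cons_zero, Fin.cons_succ, ← Fin.succ_castSucc]
  rw [h1, pathProb, h2 fun z => muM z.1 z.2.1 * muP z.1 z.2.2,
    h3 fun y z => M.trans y.1 y.2.1 z.1, Fin.cons_zero]
  ring

/-- Expectation over paths, conditioned on the first action and the first transition. -/
theorem sum_pathProb_succ (s : S) (T : ℕ) (F : (Fin (T + 1 + 1) → Triple S A Ω) → ℝ) :
    ∑ z, M.pathProb muM muP s (T + 1) z * F z =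
      ∑ a, ∑ p, muM s a * muP s p * ∑ s', M.trans s a s' *
        ∑ w, M.pathProb muM muP s' T w * F (Fin.cons ⟨s, a, p⟩ w) := by
  classical
  rw [← (Fin.consEquiv fun _ => Triple S A Ω).sum_comp, Fintype.sum_prod_type,
    Fintype.sum_sigma, Finset.sum_eq_single s]
  · rw [Fintype.sum_prod_type]
    refine Finset.sum_congr rfl fun a _ => Finset.sum_congr rfl fun p _ => ?_
    simp only [Fin.consEquiv, Equiv.coe_fn_mk, pathProb_cons, if_true, one_mul]
    simp only [mul_assoc, Finset.mul_sum, Finset.sum_mul]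
    rw [Finset.sum_comm]
  · intro b _ hb
    refine Finset.sum_eq_zero fun u _ => Finset.sum_eq_zero fun w _ => ?_
    simp [Fin.consEquiv, pathProb_cons, hb]
  · simp

theorem sum_pathProb_zero (s : S) (F : (Fin (0 + 1) → Triple S A Ω) → ℝ) :
    ∑ z, M.pathProb muM muP s 0 z * F z =
      ∑ a, ∑ p, muM s a * muP s p * F fun _ => ⟨s, a, p⟩ := by
  classical
  rw [← (Equiv.funUnique (Fin 1) (Triple S A Ω)).symm.sum_comp, Fintype.sum_sigma,
    Finset.sum_eq_single s]
  · rw [Fintype.sum_prod_type]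
    refine Finset.sum_congr rfl fun a _ => Finset.sum_congr rfl fun p _ => ?_
    simp [pathProb]
    rfl
  · intro b _ hb
    refine Finset.sum_eq_zero fun u _ => ?_
    simp [pathProb, hb]
  · simp

theorem IsPolicy.sum_mul_sum (h : IsPolicy muM muP) (s : S) :
    ∑ a, ∑ p, muM s a * muP s p = 1 := by
  simp only [← Finset.mul_sum, (h.2 s).2, mul_one, (h.1 s).2]

theorem IsPolicy.sum_pathProb (h : IsPolicy muM muP) (T : ℕ) (s : S) :
    ∑ z, M.pathProb muM muP s T z = 1 := by
  induction T generalizing s with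
  | zero => simpa [h.sum_mul_sum] using sum_pathProb_zero (M := M) (muM := muM) (muP := muP) s 1
  | succ T ih =>
    simpa [h.sum_mul_sum, ih, M.trans_sum] using
      sum_pathProb_succ (M := M) (muM := muM) (muP := muP) s T 1

theorem expectedTotalCost_zero (s : S) :
    M.expectedTotalCost muM muP s 0 = M.stageReward muM muP s := by
  rw [expectedTotalCost, sum_pathProb_zero]
  simp [stageReward]

theorem IsPolicy.sum_mul_of_fst (h : IsPolicy muM muP) (s : S) (f : S → ℝ) :
    ∑ a, ∑ p, muM s a * muP s p * ∑ s', M.trans s a s' * f s' =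
      ∑ s', M.transMatrix muM s s' * f s' := by
  simp only [← Finset.sum_mul, ← Finset.mul_sum, (h.2 s).2, mul_one, transMatrix]
  simp only [Finset.mul_sum, Finset.sum_mul]
  rw [Finset.sum_comm]
  exact Finset.sum_congr rfl fun _ _ => Finset.sum_congr rfl fun _ _ => by ring

theorem IsPolicy.expectedTotalCost_succ (h : IsPolicy muM muP) (T : ℕ) (s : S) :
    M.expectedTotalCost muM muP s (T + 1) = M.stageReward muM muP s +
      ∑ s', M.transMatrix muM s s' * M.expectedTotalCost muM muP s' T := by
  rw [expectedTotalCost, sum_pathProb_succ, ← h.sum_mul_of_fst, stageReward,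
    ← Finset.sum_add_distrib]
  refine Finset.sum_congr rfl fun a _ => ?_
  rw [← Finset.sum_add_distrib]
  refine Finset.sum_congr rfl fun p _ => ?_
  rw [← mul_add]
  congr 1
  simp only [Fin.sum_univ_succ (n := T + 1), Fin.cons_zero, Fin.cons_succ, mul_add,
    Finset.sum_add_distrib, ← Finset.sum_mul, h.sum_pathProb, M.trans_sum, one_mul]
  rfl

/-- Under the unichain condition the average cost exists and is the stationary mean of the
one-stage cost. -/
theorem IsPolicy.hasAverageCost (h : IsPolicy muM muP) (hM : M.IsUnichain) {π : S → ℝ}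
    (hmem : π ∈ stdSimplex ℝ S) (hπ : ∀ j, ∑ i, π i * M.transMatrix muM i j = π j) (s : S) :
    M.HasAverageCost muM muP s (∑ i, π i * M.stageReward muM muP i) :=
  tendsto_valueIteration (G := fun T s => M.expectedTotalCost muM muP s T)
    (transMatrix_nonneg h) (transMatrix_sum h) (hM muM h.1) hmem hπ
    expectedTotalCost_zero h.expectedTotalCost_succ s

theorem IsPolicy.stageReward_eq (h : IsPolicy muM muP) (s : S) :
    M.stageReward muM muP s =
      ∑ a, muM s a * M.costM s a + M.weight * ∑ p, muP s p * M.costP s p := by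
  have h1 : ∀ a, ∑ p, muM s a * muP s p * M.stageCost ⟨s, a, p⟩ =
      muM s a * M.costM s a + muM s a * (M.weight * ∑ p, muP s p * M.costP s p) := by
    intro a
    have h2 : ∀ p, muM s a * muP s p * M.stageCost ⟨s, a, p⟩ =
        muM s a * M.costM s a * muP s p + muM s a * (M.weight * (muP s p * M.costP s p)) := by
      intro p
      simp only [stageCost]
      ring
    simp only [h2, Finset.sum_add_distrib, ← Finset.mul_sum, (h.2 s).2, mul_one]
  simp only [stageReward, h1, Finset.sum_add_distrib, ← Finset.sum_mul, (h.1 s).2, one_mul]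

/-! ### From solutions of the program to policies -/

/-- The stage cost is a function of `a` plus a function of `p`, so any dependence between them
within `X` is invisible to the objective. This is why replacing `X` by independent policies leaves
the cost unchanged. -/
theorem qpCost_eq : M.qpCost X = ∑ s, (∑ a, margA X s a * M.costM s a +
    M.weight * ∑ p, margP X s p * M.costP s p) := by
  simp only [qpCost, Fintype.sum_sigma, Fintype.sum_prod_type, stageCost, mul_add,
    Finset.sum_add_distrib, margA, margP, Finset.sum_mul, Finset.mul_sum]
  congr 1
  refine Finset.sum_congr rfl fun s _ => ?_
  rw [Finset.sum_comm]
  exact Finset.sum_congr rfl fun _ _ => Finset.sum_congr rfl fun _ _ => by ring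

theorem margS_mul_ctrlOf {s : S} (hs : margS X s ≠ 0) (a : A s) :
    margS X s * ctrlOf X s a = margA X s a := mul_div_cancel₀ _ hs

theorem margS_mul_powOf {s : S} (hs : margS X s ≠ 0) (p : Ω) :
    margS X s * powOf X s p = margP X s p := mul_div_cancel₀ _ hs

theorem safetyLoad_eq (M : CoDesignModel S A Ω) (muM : (s : S) → A s → ℝ) (muP : S → Ω → ℝ)
    (s : S) : M.safetyLoad muM muP s =
      ∑ s', (∑ p, M.theta s' p * muP s p) * ∑ a, M.trans s a s' * muM s a := by
  simp only [safetyLoad, Finset.sum_mul]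

theorem isPolicy_of_margS_pos (h0 : ∀ z, 0 ≤ X z) (hs : ∀ s, margS X s ≠ 0) :
    IsPolicy (ctrlOf X) (powOf X) := by
  have hpos : ∀ s, 0 ≤ margS X s := fun s =>
    Finset.sum_nonneg fun a _ => Finset.sum_nonneg fun p _ => h0 _
  refine ⟨fun s => ⟨fun a => ?_, ?_⟩, fun s => ⟨fun p => ?_, ?_⟩⟩
  · exact div_nonneg (Finset.sum_nonneg fun p _ => h0 _) (hpos s)
  · simp only [ctrlOf, ← Finset.sum_div]
    exact div_self (hs s)
  · exact div_nonneg (Finset.sum_nonneg fun p _ => h0 _) (hpos s)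
  · simp only [powOf, ← Finset.sum_div]
    rw [Finset.sum_comm]
    exact div_self (hs s)

theorem safety_sum_eq_safetyLoad (s : S) :
    ∑ s', (∑ p', M.theta s' p' * margP X s p' / margS X s) *
      (∑ a, M.trans s a s' * margA X s a / margS X s) = M.safetyLoad (ctrlOf X) (powOf X) s := by
  rw [safetyLoad_eq]
  simp only [mul_div_assoc]
  rfl

namespace QPFeasible

variable {etaBar : ℝ}

theorem isPolicy (h : M.QPFeasible etaBar X) : IsPolicy (ctrlOf X) (powOf X) :=
  isPolicy_of_margS_pos h.nonneg h.margS_ne_zero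

theorem margS_pos (h : M.QPFeasible etaBar X) (s : S) : 0 < margS X s :=
  lt_of_le_of_ne (Finset.sum_nonneg fun _ _ => Finset.sum_nonneg fun _ _ => h.nonneg _)
    (h.margS_ne_zero s).symm

theorem safetyLoad_le (h : M.QPFeasible etaBar X) (s : S) :
    M.safetyLoad (ctrlOf X) (powOf X) s ≤ etaBar :=
  safety_sum_eq_safetyLoad (M := M) (X := X) s ▸ h.safety s

theorem margS_mem (h : M.QPFeasible etaBar X) : margS X ∈ stdSimplex ℝ S := by
  refine ⟨fun s => (h.margS_pos s).le, ?_⟩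
  rw [h.total, Fintype.sum_sigma]
  exact Finset.sum_congr rfl fun s _ => by rw [margS, Fintype.sum_prod_type]

theorem stationary (h : M.QPFeasible etaBar X) (s' : S) :
    ∑ s, margS X s * M.transMatrix (ctrlOf X) s s' = margS X s' := by
  have h1 : ∀ s, margS X s * M.transMatrix (ctrlOf X) s s' =
      ∑ a, M.trans s a s' * margA X s a := fun s => by
    rw [transMatrix, Finset.mul_sum]
    refine Finset.sum_congr rfl fun a _ => ?_
    rw [← margS_mul_ctrlOf (h.margS_ne_zero s)]
    ring
  simp only [h1]
  have h2 := h.balance s'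
  have h3 : margS X s' = ∑ a, margA X s' a := rfl
  linarith

theorem isRecurrent (h : M.QPFeasible etaBar X) (s : S) :
    IsRecurrent (M.transMatrix (ctrlOf X)) s :=
  isRecurrent_of_stationary_pos (transMatrix_nonneg h.isPolicy) (transMatrix_sum h.isPolicy)
    h.margS_pos h.stationary s

theorem hasAverageCost (h : M.QPFeasible etaBar X) (hM : M.IsUnichain) (s : S) :
    M.HasAverageCost (ctrlOf X) (powOf X) s (M.qpCost X) := by
  have h1 := h.isPolicy.hasAverageCost hM h.margS_mem h.stationary s
  convert h1 using 1
  rw [qpCost_eq]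
  refine Finset.sum_congr rfl fun s _ => ?_
  rw [h.isPolicy.stageReward_eq]
  simp only [← margS_mul_ctrlOf (h.margS_ne_zero s), ← margS_mul_powOf (h.margS_ne_zero s),
    mul_add, Finset.mul_sum]
  congr 1
  · exact Finset.sum_congr rfl fun _ _ => by ring
  · exact Finset.sum_congr rfl fun _ _ => by ring

end QPFeasible

/-! ### From policies to solutions of the program -/

/-- The occupation measure of a policy with stationary distribution `π`. -/
def occupation (π : S → ℝ) (muM : (s : S) → A s → ℝ) (muP : S → Ω → ℝ) (z : Triple S A Ω) : ℝ :=
  π z.1 * (muM z.1 z.2.1 * muP z.1 z.2.2)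

section occupation

variable {π : S → ℝ}

theorem margA_occupation (h : IsPolicy muM muP) (s : S) (a : A s) :
    margA (occupation π muM muP) s a = π s * muM s a := by
  simp only [margA, occupation, ← Finset.mul_sum, (h.2 s).2, mul_one]

theorem margP_occupation (h : IsPolicy muM muP) (s : S) (p : Ω) :
    margP (occupation π muM muP) s p = π s * muP s p := by
  simp only [margP, occupation, ← Finset.mul_sum, ← Finset.sum_mul, (h.1 s).2, one_mul]

theorem margS_occupation (h : IsPolicy muM muP) (s : S) :
    margS (occupation π muM muP) s = π s := by
  change ∑ a, margA (occupation π muM muP) s a = π s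
  simp only [margA_occupation h, ← Finset.mul_sum, (h.1 s).2, mul_one]

/-- Positivity is essential: where `π s = 0` the quotient is `0 / 0 = 0` and the policy is lost.
This confines the exact correspondence to chains without transient states. -/
theorem ctrlOf_occupation (h : IsPolicy muM muP) (hπ : ∀ s, 0 < π s) :
    ctrlOf (occupation π muM muP) = muM := by
  ext s a
  change margA (occupation π muM muP) s a / margS (occupation π muM muP) s = muM s a
  rw [margA_occupation h, margS_occupation h, mul_div_cancel_left₀ _ (hπ s).ne']

theorem powOf_occupation (h : IsPolicy muM muP) (hπ : ∀ s, 0 < π s) :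
    powOf (occupation π muM muP) = muP := by
  ext s p
  change margP (occupation π muM muP) s p / margS (occupation π muM muP) s = muP s p
  rw [margP_occupation h, margS_occupation h, mul_div_cancel_left₀ _ (hπ s).ne']

theorem occupation_nonneg (h : IsPolicy muM muP) (h0 : ∀ s, 0 ≤ π s) (z : Triple S A Ω) :
    0 ≤ occupation π muM muP z :=
  mul_nonneg (h0 _) (mul_nonneg ((h.1 _).1 _) ((h.2 _).1 _))

theorem sum_occupation (h : IsPolicy muM muP) : ∑ z, occupation π muM muP z = ∑ s, π s := by
  rw [Fintype.sum_sigma]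
  refine Finset.sum_congr rfl fun s _ => ?_
  rw [Fintype.sum_prod_type]
  exact margS_occupation h s

theorem balance_occupation (h : IsPolicy muM muP)
    (hπ : ∀ j, ∑ i, π i * M.transMatrix muM i j = π j) (s' : S) :
    0 = ∑ a, margA (occupation π muM muP) s' a -
      ∑ s, ∑ a, M.trans s a s' * margA (occupation π muM muP) s a := by
  simp only [margA_occupation h, ← Finset.mul_sum, (h.1 _).2, mul_one, mul_left_comm _ (π _)]
  exact (sub_eq_zero.2 (hπ s').symm).symm

theorem qpCost_occupation :
    M.qpCost (occupation π muM muP) = ∑ s, π s * M.stageReward muM muP s := by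
  simp only [qpCost, Fintype.sum_sigma, Fintype.sum_prod_type, occupation, stageReward,
    Finset.mul_sum, mul_assoc]

theorem qpFeasible_occupation {etaBar : ℝ} (h : IsPolicy muM muP) (hmem : π ∈ stdSimplex ℝ S)
    (hπ : ∀ j, ∑ i, π i * M.transMatrix muM i j = π j) (hpos : ∀ s, 0 < π s)
    (hsafe : ∀ s, M.safetyLoad muM muP s ≤ etaBar) :
    M.QPFeasible etaBar (occupation π muM muP) where
  nonneg := occupation_nonneg h hmem.1
  balance := balance_occupation h hπ
  total := by rw [sum_occupation h, hmem.2]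
  margS_ne_zero s := by rw [margS_occupation h]; exact (hpos s).ne'
  safety s := by
    rw [safety_sum_eq_safetyLoad, ctrlOf_occupation h hpos, powOf_occupation h hpos]
    exact hsafe s

end occupation

/-- A safe policy without transient states is given by a feasible point of the program. -/
theorem IsPolicy.exists_qpFeasible {etaBar : ℝ} (h : IsPolicy muM muP) (hM : M.IsUnichain)
    (hsafe : ∀ s, M.safetyLoad muM muP s ≤ etaBar)
    (hrec : ∀ s, IsRecurrent (M.transMatrix muM) s) [Nonempty S] :
    ∃ X, M.QPFeasible etaBar X ∧ ctrlOf X = muM ∧ powOf X = muP := by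
  obtain ⟨π, hmem, hπ⟩ := exists_stationary (transMatrix_nonneg (M := M) h) (transMatrix_sum h)
  have hpos := stationary_pos (transMatrix_nonneg h) (hM muM h.1) hrec hmem hπ
  exact ⟨_, qpFeasible_occupation h hmem hπ hpos hsafe, ctrlOf_occupation h hpos,
    powOf_occupation h hpos⟩

/-! ### Convex combinations -/

section convex

variable {Y : Triple S A Ω → ℝ} {a b : ℝ}

theorem margA_combo (s : S) (c : A s) :
    margA (a • X + b • Y) s c = a * margA X s c + b * margA Y s c := by
  simp [margA, Finset.sum_add_distrib, Finset.mul_sum]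

theorem margS_combo (s : S) : margS (a • X + b • Y) s = a * margS X s + b * margS Y s := by
  simp [margS, Finset.sum_add_distrib, Finset.mul_sum]

theorem qpCost_combo : M.qpCost (a • X + b • Y) = a * M.qpCost X + b * M.qpCost Y := by
  simp [qpCost, add_mul, Finset.sum_add_distrib, Finset.mul_sum, mul_assoc]

theorem balance_combo (s' : S)
    (hX : 0 = ∑ c, margA X s' c - ∑ s, ∑ c, M.trans s c s' * margA X s c)
    (hY : 0 = ∑ c, margA Y s' c - ∑ s, ∑ c, M.trans s c s' * margA Y s c) :
    0 = ∑ c, margA (a • X + b • Y) s' c -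
      ∑ s, ∑ c, M.trans s c s' * margA (a • X + b • Y) s c := by
  simp only [margA_combo, mul_add, Finset.sum_add_distrib, mul_left_comm _ a, mul_left_comm _ b,
    ← Finset.mul_sum]
  linear_combination a * hX + b * hY

theorem total_combo (hX : 1 = ∑ z, X z) (hY : 1 = ∑ z, Y z) (hab : a + b = 1) :
    1 = ∑ z, (a • X + b • Y) z := by
  simp only [Pi.add_apply, Pi.smul_apply, smul_eq_mul, Finset.sum_add_distrib, ← Finset.mul_sum,
    ← hX, ← hY, mul_one, hab]

end convex

/-- If the matrices of the safety constraints are negative semidefinite, the feasible set is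
convex. -/
theorem convex_qpFeasible {etaBar : ℝ} (hQ : ∀ s, (-(M.safetyQ etaBar s)).PosSemidef) :
    Convex ℝ {X | M.QPFeasible etaBar X} := by
  -- Feasibility and semidefiniteness force the form to vanish at `X`, and a semidefinite form
  -- vanishes only on the kernel of its matrix.
  have hker : ∀ X, M.QPFeasible etaBar X → ∀ s, (M.safetyQ etaBar s).mulVec X = 0 := by
    intro X hX s
    have h1 := (safety_iff M etaBar s X (hX.margS_ne_zero s)).1 (hX.safety s)
    have h2 := (hQ s).dotProduct_mulVec_nonneg X
    have h3 := (hQ s).dotProduct_mulVec_zero_iff X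
    simp only [star_trivial, Matrix.neg_mulVec, dotProduct_neg, neg_eq_zero] at h2 h3
    exact h3.1 (by linarith)
  intro X hX Y hY a b ha hb hab
  have hpos : ∀ s, margS (a • X + b • Y) s ≠ 0 := fun s => by
    rw [margS_combo]
    have hx := hX.margS_pos s
    have hy := hY.margS_pos s
    rcases ha.eq_or_lt with rfl | ha'
    · have : b = 1 := by linarith
      subst this
      linarith
    · have := mul_pos ha' hx
      have := mul_nonneg hb hy.le
      linarith
  refine ⟨fun z => ?_, fun s' => balance_combo s' (hX.balance s') (hY.balance s'),
    total_combo hX.total hY.total hab, hpos, fun s => ?_⟩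
  · exact add_nonneg (mul_nonneg ha (hX.nonneg z)) (mul_nonneg hb (hY.nonneg z))
  · rw [safety_iff M etaBar s _ (hpos s), Matrix.mulVec_add, Matrix.mulVec_smul,
      Matrix.mulVec_smul, hker X hX s, hker Y hY s]
    simp

/-! ### Negative semidefinite safety matrices -/

/-- With weight 1 in every state, `X(s) = 1` and the marginals are the policies themselves. No signs
are assumed, so the form can also be tested on extrapolated policies. -/
theorem safetyForm_product {etaBar : ℝ} {s : S} (hm : ∑ a, muM s a = 1) (hp : ∑ p, muP s p = 1) :
    M.safetyForm etaBar s (occupation 1 muM muP) = etaBar - M.safetyLoad muM muP s := by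
  have hA : ∀ a, margA (occupation 1 muM muP) s a = muM s a := fun a => by
    simp only [margA, occupation, Pi.one_apply, one_mul, ← Finset.mul_sum, hp, mul_one]
  have hP : ∀ p, margP (occupation 1 muM muP) s p = muP s p := fun p => by
    simp only [margP, occupation, Pi.one_apply, one_mul, ← Finset.sum_mul, hm]
  have hS : margS (occupation 1 muM muP) s = 1 := by
    change ∑ a, margA (occupation 1 muM muP) s a = 1
    simp only [hA, hm]
  rw [safetyForm, safetyLoad_eq, hS]
  simp only [hA, hP]
  ring

/-- If the safety matrix of `s` is negative semidefinite, then all signed policies have at least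
the load `etaBar` in `s`. -/
theorem le_safetyLoad_of_posSemidef {etaBar : ℝ} {s : S}
    (hQ : (-(M.safetyQ etaBar s)).PosSemidef) (hm : ∑ a, muM s a = 1) (hp : ∑ p, muP s p = 1) :
    etaBar ≤ M.safetyLoad muM muP s := by
  have h2 := hQ.dotProduct_mulVec_nonneg (occupation 1 muM muP)
  simp only [star_trivial, Matrix.neg_mulVec, dotProduct_neg, dotProduct_safetyQ] at h2
  rw [safetyForm_product hm hp] at h2
  linarith

/-- If the safety matrix of `s` is negative semidefinite and some policy is safe in `s`, then all
policies are safe in `s`: the load is a biaffine function of the policies that is bounded below by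
`etaBar` on signed policies and attains this bound. -/
theorem safetyLoad_le_of_posSemidef {etaBar : ℝ} {s : S}
    (hQ : (-(M.safetyQ etaBar s)).PosSemidef) {nuM : (s : S) → A s → ℝ} {nuP : S → Ω → ℝ}
    (hmu : IsPolicy muM muP) (hsafe : M.safetyLoad muM muP s ≤ etaBar) (hnu : IsPolicy nuM nuP) :
    M.safetyLoad nuM nuP s ≤ etaBar := by
  set F : ℝ → ℝ → ℝ := fun u v => M.safetyLoad (fun s a => (1 - u) * muM s a + u * nuM s a)
    (fun s p => (1 - v) * muP s p + v * nuP s p) s with hF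
  have hge : ∀ u v, etaBar ≤ F u v := fun u v => by
    refine le_safetyLoad_of_posSemidef hQ ?_ ?_
    · simp only [Finset.sum_add_distrib, ← Finset.mul_sum, (hmu.1 s).2, (hnu.1 s).2]
      ring
    · simp only [Finset.sum_add_distrib, ← Finset.mul_sum, (hmu.2 s).2, (hnu.2 s).2]
      ring
  have hexp : ∀ u v, F u v = (1 - u) * (1 - v) * M.safetyLoad muM muP s +
      u * (1 - v) * M.safetyLoad nuM muP s + (1 - u) * v * M.safetyLoad muM nuP s +
      u * v * M.safetyLoad nuM nuP s := fun u v => by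
    simp only [hF, safetyLoad_eq, mul_add, Finset.sum_add_distrib, mul_left_comm _ (1 - u),
      mul_left_comm _ u, mul_left_comm _ (1 - v), mul_left_comm _ v, ← Finset.mul_sum]
    have hS : ∀ (c : ℝ) (f : S → ℝ), c * ∑ x, f x = ∑ x, c * f x := fun c f => Finset.mul_sum _ _ _
    simp only [hS, ← Finset.sum_add_distrib]
    exact Finset.sum_congr rfl fun _ _ => by ring
  -- With `L_uv = F u v` at the corners, `v = -1` gives `2 L_00 - L_01 ≥ etaBar`, so `L_01 ≤ etaBar`
  -- because `L_00 ≤ etaBar`. Then `(u, v) = (-1, 1)` gives `2 L_01 - L_11 ≥ etaBar`, hence `L_11 ≤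
  -- etaBar`.
  have h1 := hge (-1) 0
  have h2 := hge 0 (-1)
  have h3 := hge (-1) 1
  have h4 := hge 1 0
  have h5 := hge 0 1
  rw [hexp] at h1 h2 h3 h4 h5
  linarith

/-- A solution of the program is optimal among all policies if all policies are safe. -/
theorem IsQPOptimal.exists_le {etaBar : ℝ} (hX : M.IsQPOptimal etaBar X) (hM : M.IsUnichain)
    (hall : ∀ nuM nuP, IsPolicy nuM nuP → ∀ s, M.safetyLoad nuM nuP s ≤ etaBar)
    (h : IsPolicy muM muP) (s0 : S) :
    ∃ J, M.HasAverageCost muM muP s0 J ∧ M.qpCost X ≤ J := by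
  have : Nonempty S := ⟨s0⟩
  obtain ⟨π, hmem, hπ⟩ := exists_stationary (transMatrix_nonneg (M := M) h) (transMatrix_sum h)
  refine ⟨_, h.hasAverageCost hM hmem hπ s0, ?_⟩
  rw [← qpCost_occupation]
  set Y := occupation π muM muP with hY
  have h0 : ∀ z, 0 ≤ Y z := occupation_nonneg h hmem.1
  -- `Y` may vanish in transient states and so be infeasible, but the midpoint has positive mass
  -- everywhere. Its safety comes from `hall`, not from convexity of the feasible set. Linearity of
  -- the cost then turns optimality against the midpoint into `qpCost X ≤ qpCost Y`.
  have hne : ∀ s, margS ((1 / 2 : ℝ) • X + (1 / 2 : ℝ) • Y) s ≠ 0 := fun s => by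
    rw [margS_combo, hY, margS_occupation h]
    linarith [hX.1.margS_pos s, hmem.1 s]
  have hnn : ∀ z, 0 ≤ ((1 / 2 : ℝ) • X + (1 / 2 : ℝ) • Y) z := fun z => by
    have := hX.1.nonneg z
    have := h0 z
    simp only [Pi.add_apply, Pi.smul_apply, smul_eq_mul]
    linarith
  have hfeas : M.QPFeasible etaBar ((1 / 2 : ℝ) • X + (1 / 2 : ℝ) • Y) :=
    ⟨hnn, fun s' => balance_combo s' (hX.1.balance s') (balance_occupation h hπ s'),
      total_combo hX.1.total (by rw [hY, sum_occupation h, hmem.2]) (by norm_num), hne,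
      fun s => by
        rw [safety_sum_eq_safetyLoad]
        exact hall _ _ (isPolicy_of_margS_pos hnn hne) s⟩
  have hle := hX.2 _ hfeas
  rw [qpCost_combo] at hle
  linarith

theorem threshold_lt_threshold {rho lam0 lam1 eta eta' : ℝ} (hrho : 0 < rho) (hlam : lam1 < lam0)
    (heta : eta < eta') : threshold rho lam0 lam1 eta < threshold rho lam0 lam1 eta' :=
  div_lt_div_of_pos_right (by linarith) (mul_pos hrho (by linarith))

end CoDesignModel

/-! ### The program and the co-design problem -/

theorem mainTheorem5 {S : Type*} [Fintype S] {A : S → Type*} [∀ s, Fintype (A s)]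
    {Ω : Type*} [Fintype Ω] (M : CoDesignModel S A Ω) (hM : M.IsUnichain)
    (rho lam0 lam1 eta : ℝ) (hrho : 0 < rho) (hlam : lam1 < lam0) (heta : eta < 1) :
    -- If the matrices are negative semidefinite, the program is convex and its optimal solutions
    -- yield optimal stationary policies.
    ((∀ s, (-(M.safetyQ (CoDesignModel.threshold rho lam0 lam1 eta) s)).PosSemidef) →
      ConvexOn ℝ {X | M.QPFeasible (CoDesignModel.threshold rho lam0 lam1 eta) X} M.qpCost ∧
      ∀ X, M.IsQPOptimal (CoDesignModel.threshold rho lam0 lam1 eta) X → ∀ s0 : S,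
        M.IsOptimalPolicy (M.IsASASSafe rho lam0 lam1) s0
          (CoDesignModel.ctrlOf X) (CoDesignModel.powOf X) ∧
        M.IsOptimalPolicy (M.IsRateSafe rho lam0 lam1 eta) s0
          (CoDesignModel.ctrlOf X) (CoDesignModel.powOf X) ∧
        M.HasAverageCost (CoDesignModel.ctrlOf X) (CoDesignModel.powOf X) s0 (M.qpCost X)) ∧
    -- In any case, the optimal solutions of the program yield exactly the safe stationary policies
    -- that are optimal among those without transient states.
    (∀ X, M.IsQPOptimal (CoDesignModel.threshold rho lam0 lam1 eta) X → ∀ s0 : S,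
      M.IsOptimalPolicy (fun muM muP => M.IsRateSafe rho lam0 lam1 eta muM muP ∧
          ∀ s, CoDesignModel.IsRecurrent (M.transMatrix muM) s) s0
        (CoDesignModel.ctrlOf X) (CoDesignModel.powOf X) ∧
      M.HasAverageCost (CoDesignModel.ctrlOf X) (CoDesignModel.powOf X) s0 (M.qpCost X)) ∧
    (∀ (s0 : S) (muM : (s : S) → A s → ℝ) (muP : S → Ω → ℝ),
      M.IsOptimalPolicy (fun muM muP => M.IsRateSafe rho lam0 lam1 eta muM muP ∧
          ∀ s, CoDesignModel.IsRecurrent (M.transMatrix muM) s) s0 muM muP →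
      ∃ X, M.IsQPOptimal (CoDesignModel.threshold rho lam0 lam1 eta) X ∧
        CoDesignModel.ctrlOf X = muM ∧ CoDesignModel.powOf X = muP) := by
  refine ⟨fun hQ => ⟨⟨CoDesignModel.convex_qpFeasible hQ, fun X _ Y _ a b _ _ _ =>
    CoDesignModel.qpCost_combo.le⟩, fun X hX s0 => ?_⟩, fun X hX s0 => ?_,
    fun s0 muM muP hopt => ?_⟩
  · have hall : ∀ nuM nuP, CoDesignModel.IsPolicy nuM nuP → ∀ s, M.safetyLoad nuM nuP s ≤
        CoDesignModel.threshold rho lam0 lam1 eta := fun nuM nuP hnu s =>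
      CoDesignModel.safetyLoad_le_of_posSemidef (hQ s) hX.1.isPolicy (hX.1.safetyLoad_le s) hnu
    have hcost := hX.1.hasAverageCost hM s0
    have hbest := fun nuM nuP (h : CoDesignModel.IsPolicy nuM nuP) => hX.exists_le hM hall h s0
    -- Since `eta < 1`, the rate threshold lies strictly below the ASAS threshold. The bound `hbest`
    -- holds against all policies, so it serves both constraints.
    exact ⟨⟨hX.1.isPolicy, fun s => (hX.1.safetyLoad_le s).trans_lt
        (CoDesignModel.threshold_lt_threshold hrho hlam heta), _, hcost,
        fun nuM nuP h _ => hbest nuM nuP h⟩,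
      ⟨hX.1.isPolicy, hX.1.safetyLoad_le, _, hcost, fun nuM nuP h _ => hbest nuM nuP h⟩, hcost⟩
  · have : Nonempty S := ⟨s0⟩
    have hcost := hX.1.hasAverageCost hM s0
    refine ⟨⟨hX.1.isPolicy, ⟨hX.1.safetyLoad_le, hX.1.isRecurrent⟩, _, hcost, ?_⟩, hcost⟩
    rintro nuM nuP h ⟨hsafe, hrec⟩
    obtain ⟨Y, hY, rfl, rfl⟩ := h.exists_qpFeasible hM hsafe hrec
    exact ⟨_, hY.hasAverageCost hM s0, hX.2 Y hY⟩
  · have : Nonempty S := ⟨s0⟩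
    obtain ⟨h, ⟨hsafe, hrec⟩, J, hJ, hbest⟩ := hopt
    obtain ⟨X, hX, rfl, rfl⟩ := h.exists_qpFeasible hM hsafe hrec
    refine ⟨X, ⟨hX, fun Y hY => ?_⟩, rfl, rfl⟩
    -- Every feasible `Y` defines an admissible competitor, and uniqueness of limits identifies both
    -- costs with objective values. These do not involve `s0`, so optimality from a single initial
    -- state suffices.
    obtain ⟨J', hJ', hle⟩ := hbest _ _ hY.isPolicy ⟨hY.safetyLoad_le, hY.isRecurrent⟩
    rw [tendsto_nhds_unique (hX.hasAverageCost hM s0) hJ,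
      tendsto_nhds_unique (hY.hasAverageCost hM s0) hJ']
    exact hle
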